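/- Let $n\ge 1$ and $[n]=\{1,\dots,n\}$. A binary tree is a finite rooted plane tree in which every vertex has either $2$ children (a left-child and a right-child; the vertex is then called a node) or $0$ children (a leaf). An $[n]$-decorated binary tree is a binary tree $T$ (possibly a single leaf), considered up to isomorphism, in which each node is labeled with a non-empty subset of $[n]$, the labels of the nodes forming a partition of $[n]$, and in which each right edge joining two nodes is declared either solid or dashed (all other edges are solid). A node is captive if it is joined to its parent by a dashed edge, and free otherwise. For a vertex $v$, let $\rho(v)$ be the word in $E_0,E_1$ recording the path from the root to $v$ ($E_0$ for a left edge, $E_1$ for a right edge) and let $\dot\rho(v)$ be the number of letters $E_1$ in it. For vertices $v\ne w$ write $v\prec_T w$ if $\dot\rho(v)<\dot\rho(w)$, or if $\dot\rho(v)=\dot\rho(w)$ and either $\rho(v)$ is a proper prefix of $\rho(w)$ or at the first index at which they differ $\rho(v)$ has $E_1$ and $\rho(w)$ has $E_0$; write $v\preceq_T w$ if $v=w$ or $v\prec_T w$. For $i\in[n]$ let $v_T(i)$ be the unique node whose label contains $i$, and $v_T^1(i)$ its right-child. The Catalan arrangement in $\mathbb R^n$ consists of the hyperplanes $x_i-x_j=s$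 with $i,j\in[n]$, $s\in\{0,1\}$. A Catalan face is a non-empty solution set in $\mathbb R^n$ of a system that contains, for each $(i,j,s)$, exactly one of $x_i-x_j<s$, $x_i-x_j=s$, $x_i-x_j>s$; its dimension is the dimension of its affine span. Theorem. For any $[n]$-decorated binary tree $T$ there exists a unique Catalan face $\Phi(T)$ in $\mathbb R^n$ consisting of all points $p=(p_1,\dots,p_n)$ for which the following three conditions hold: 1. for all $i,j\in[n]$, $p_i\le p_j$ if and only if $v_T(i)\preceq_T v_T(j)$; 2. for all $i,j\in[n]$, $p_i<p_j+1$ if and only if $v_T(i)\prec_T v_T^1(j)$; 3. for all $i,j\in[n]$, $p_i=p_j+1$ if and only if $v_T(i)=v_T^1(j)$ and $v_T^1(j)$ is a captive node. The map $T\mapsto\Phi(T)$ is a bijection from $[n]$-decorated binary trees to Catalan faces in $\mathbb R^n$. Furthermore, an $[n]$-decorated binary tree $T$ has $k$ free nodes if and only if $\Phi(T)$ is a face of dimension $k$. -/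

import Mathlib

/-! ### Binary trees with decorations -/

/-- Rooted plane trees in which every vertex has `0` children (`leaf`) or `2` children (`node`).
A node carries a set of labels, the type (`dashed = true`, or solid) of the edge to its right child,
its left subtree and its right subtree. -/
inductive LabeledTree (n : ℕ) : Type
  | leaf : LabeledTree n
  | node (label : Finset (Fin n)) (dashed : Bool) (left right : LabeledTree n) : LabeledTree n

namespace LabeledTree

variable {n : ℕ}

/-- A vertex `v` is represented by the word `ρ(v)` of the path from the root to `v`:
`false` is the letter `E₀` (a left edge) and `true` is the letter `E₁` (a right edge).
`t.subtreeAt w` is the subtree of `t` rooted at the end of the path `w`,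
and `none` if `w` runs out of the tree. -/
def subtreeAt : LabeledTree n → List Bool → Option (LabeledTree n)
  | t, [] => some t
  | leaf, _ :: _ => none
  | node _ _ l _, false :: w => l.subtreeAt w
  | node _ _ _ r, true :: w => r.subtreeAt w

/-- `t.IsNode w A`: the word `w` is (the path to) a node of `t`, and this node has label `A`. -/
def IsNode (t : LabeledTree n) (w : List Bool) (A : Finset (Fin n)) : Prop :=
  ∃ d l r, t.subtreeAt w = some (node A d l r)

/-- A tree has finitely many nodes, so that counting them with `Set.ncard` is meaningful. -/
theorem finite_setOf_isNode (t : LabeledTree n) : {w | ∃ A, t.IsNode w A}.Finite := by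
  induction t with
  | leaf =>
    refine Set.Finite.subset Set.finite_empty ?_
    rintro (_ | ⟨b, w⟩) ⟨A, d, l, r, h⟩ <;> simp [subtreeAt] at h
  | node B e l r hl hr =>
    refine (((hl.image (List.cons false)).union (hr.image (List.cons true))).insert []).subset ?_
    rintro (_ | ⟨_ | _, w⟩) ⟨A, h⟩
    · exact Or.inl rfl
    · exact Or.inr (Or.inl ⟨w, ⟨A, h⟩, rfl⟩)
    · exact Or.inr (Or.inr ⟨w, ⟨A, h⟩, rfl⟩)

end LabeledTree

/-- `[n]`-decorated binary trees (with `Fin n` in the role of `[n]`). -/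
structure DecoratedBinaryTree (n : ℕ) where
  /-- the underlying labeled tree -/
  tree : LabeledTree n
  /-- node labels are non-empty -/
  label_nonempty : ∀ w A, tree.IsNode w A → A.Nonempty
  /-- the node labels partition `[n]`: every `i` lies in the label of exactly one node -/
  label_partition : ∀ i : Fin n, ∃! w, ∃ A, tree.IsNode w A ∧ i ∈ A
  /-- only internal right edges can be dashed: a right edge to a leaf is solid -/
  dashed_internal : ∀ w A l, tree.subtreeAt w ≠ some (.node A true l .leaf)

/-- The relation `v ≺ w` on vertices, given by their words. -/
def VertexPrec (v w : List Bool) : Prop :=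
  v.count true < w.count true ∨
    (v.count true = w.count true ∧
      ((v <+: w ∧ v ≠ w) ∨ ∃ u a b, v = u ++ true :: a ∧ w = u ++ false :: b))

/-- The relation `v ≼ w` on vertices. -/
def VertexPreceq (v w : List Bool) : Prop := v = w ∨ VertexPrec v w

namespace DecoratedBinaryTree

variable {n : ℕ}

/-- A captive node: a node that is joined to its parent by a dashed edge. -/
def IsCaptive (T : DecoratedBinaryTree n) (w : List Bool) : Prop :=
  (∃ A, T.tree.IsNode w A) ∧
    ∃ u B l r, w = u ++ [true] ∧ T.tree.subtreeAt u = some (.node B true l r)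

/-- The set of free nodes: the nodes that are not captive. -/
def freeNodes (T : DecoratedBinaryTree n) : Set (List Bool) :=
  {w | (∃ A, T.tree.IsNode w A) ∧ ¬ T.IsCaptive w}

/-- The number of free nodes. -/
noncomputable def numFree (T : DecoratedBinaryTree n) : ℕ := T.freeNodes.ncard

/-- `v_T(i)`: the unique node whose label contains `i`. -/
noncomputable def nodeOf (T : DecoratedBinaryTree n) (i : Fin n) : List Bool :=
  (T.label_partition i).choose

/-- `v¹_T(i)`: the right child of `v_T(i)`. -/
noncomputable def rightChildOf (T : DecoratedBinaryTree n) (i : Fin n) : List Bool :=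
  T.nodeOf i ++ [true]

/-- The set of points of `ℝⁿ` that satisfy the three conditions attached to `T`. -/
def points (T : DecoratedBinaryTree n) : Set (Fin n → ℝ) :=
  {p | (∀ i j, p i ≤ p j ↔ VertexPreceq (T.nodeOf i) (T.nodeOf j)) ∧
    (∀ i j, p i < p j + 1 ↔ VertexPrec (T.nodeOf i) (T.rightChildOf j)) ∧
    (∀ i j, p i = p j + 1 ↔ T.nodeOf i = T.rightChildOf j ∧ T.IsCaptive (T.rightChildOf j))}

end DecoratedBinaryTree

/-! ### Faces of the Catalan arrangement -/

/-- The faces of the Catalan arrangement `x_i - x_j = s` (`i, j ∈ [n]`, `s ∈ {0, 1}`) in `ℝⁿ`: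
the non-empty solution sets of systems that choose, for each `(i, j, s)`, one of
`x_i - x_j < s`, `x_i - x_j = s`, `x_i - x_j > s` (`σ i j s = -1, 0, 1`).
For `i = j` non-emptiness forces the choice, so these indices have no influence. -/
def IsCatalanFace {n : ℕ} (F : Set (Fin n → ℝ)) : Prop :=
  F.Nonempty ∧ ∃ σ : Fin n → Fin n → Fin 2 → SignType,
    F = {x | ∀ (i j : Fin n) (s : Fin 2), SignType.sign (x i - x j - ((s : ℕ) : ℝ)) = σ i j s}

/-- The type of Catalan faces in `ℝⁿ`. -/
def CatalanFace (n : ℕ) : Type := {F : Set (Fin n → ℝ) // IsCatalanFace F}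

/-- The dimension of a face: the dimension of its affine span. -/
noncomputable def CatalanFace.dim {n : ℕ} (F : CatalanFace n) : ℕ :=
  Module.finrank ℝ (affineSpan ℝ F.1).direction

/-! Three facts about the vertex order carry the argument: a child comes after its parent, taking
right children preserves the order, and the left child is the immediate successor of its parent. So
if a node stands for the real number `v`, its right child marks the position of `v + 1` among the
values, and its left child the next position after `v`.

From a tree to a point (`exists_heights`): heights are assigned to the nodes in increasing order. A
captive node must sit at its parent's height plus one; a free node may take any height in a
non-empty open interval.

From a point to a tree (`exists_words`): the distinct coordinates receive words in increasing order.
Let `x` be the new value and `y` the previous one. If some `z + 1` lies in `(y, x]`, then `x`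
becomes the right child of the largest `m` with `m + 1 ≤ x`; otherwise it becomes the left child of
`y`. Parent and side are forced (`Realizes.word_unique`), and condition 3 determines the captive
nodes.

Hence each point lies in the set of exactly one tree, and that set is a full sign class, that is, a
face. Its directions are the vectors respecting the equalities tight at a point; these identify each
captive node with its parent, so every dashed chain contributes one dimension, counted by its unique
free node. -/

/-! ### The vertex order through lexicographic keys -/

/-- The order of the vertices by `VertexPrec` is the order of these keys. -/
def vertexKey (v : List Bool) : ℕ ×ₗ List Bool := toLex (v.count true, v.map not)

/-- Negating letters is needed because `E₁` precedes `E₀` while `false < true`; the lexicographic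
order already puts proper prefixes first. -/
theorem List.map_not_lt_map_not_iff (v w : List Bool) :
    v.map not < w.map not ↔
      (v <+: w ∧ v ≠ w) ∨ ∃ u a b, v = u ++ true :: a ∧ w = u ++ false :: b := by
  induction v generalizing w with
  | nil => cases w <;> simp
  | cons x v ih =>
    cases w with
    | nil => simp
    | cons y w =>
      rw [List.map_cons, List.map_cons, List.cons_lt_cons_iff, ih]
      constructor
      · rintro (h | ⟨h, ⟨h1, h2⟩ | ⟨u, a, b, rfl, rfl⟩⟩)
        · right
          refine ⟨[], v, w, ?_⟩
          cases x <;> cases y <;> first | exact absurd h (by decide) | simp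
        · left
          cases x <;> cases y <;> simp_all
        · right
          refine ⟨x :: u, a, b, ?_⟩
          cases x <;> cases y <;> simp_all
      · rintro (⟨h1, h2⟩ | ⟨_ | ⟨z, u⟩, a, b, h1, h2⟩)
        · rw [List.cons_prefix_cons] at h1
          obtain ⟨rfl, h1⟩ := h1
          exact Or.inr ⟨rfl, Or.inl ⟨h1, fun h => h2 (by rw [h])⟩⟩
        · simp only [List.nil_append, List.cons.injEq] at h1 h2
          simp [h1.1, h2.1]
        · simp only [List.cons_append, List.cons.injEq] at h1 h2
          exact Or.inr ⟨by rw [h1.1, h2.1], Or.inr ⟨u, a, b, h1.2, h2.2⟩⟩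

theorem vertexPrec_iff {v w : List Bool} : VertexPrec v w ↔ vertexKey v < vertexKey w := by
  rw [VertexPrec, vertexKey, vertexKey, Prod.Lex.toLex_lt_toLex, List.map_not_lt_map_not_iff]

theorem vertexKey_injective : Function.Injective vertexKey := by
  intro v w h
  have h2 : v.map not = w.map not := congrArg (fun z => (ofLex z).2) h
  exact List.map_injective_iff.2 (fun a b => by cases a <;> cases b <;> simp) h2

theorem vertexPreceq_iff {v w : List Bool} : VertexPreceq v w ↔ vertexKey v ≤ vertexKey w := by
  rw [VertexPreceq, vertexPrec_iff, le_iff_eq_or_lt, vertexKey_injective.eq_iff]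

theorem vertexKey_lt_append_singleton (v : List Bool) (b : Bool) :
    vertexKey v < vertexKey (v ++ [b]) := by
  rw [← vertexPrec_iff]
  cases b
  · exact Or.inr ⟨by simp, Or.inl ⟨by simp, by simp⟩⟩
  · exact Or.inl (by simp)

theorem List.eq_cons_false_of_count_append_eq {v s : List Bool} (hs : s ≠ [])
    (h : v.count true = (v ++ s).count true) : ∃ t, s = false :: t := by
  rcases s with _ | ⟨_ | _, t⟩
  · exact absurd rfl hs
  · exact ⟨t, rfl⟩
  · simp at h

/-- Only the prefix case is delicate: equal counts force `w` to continue `v` with a left edge, so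
the two right children diverge right after `v`, where `E₁` comes first. -/
theorem vertexKey_rightChild_strictMono {v w : List Bool} (h : vertexKey v < vertexKey w) :
    vertexKey (v ++ [true]) < vertexKey (w ++ [true]) := by
  rw [← vertexPrec_iff] at h ⊢
  rcases h with h | ⟨h, ⟨⟨s, rfl⟩, hne⟩ | ⟨u, a, b, rfl, rfl⟩⟩
  · exact Or.inl (by simpa using h)
  · obtain ⟨t, rfl⟩ := List.eq_cons_false_of_count_append_eq (by rintro rfl; simp at hne) h
    exact Or.inr ⟨by simpa using h, Or.inr ⟨v, [], t ++ [true], by simp, by simp⟩⟩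
  · exact Or.inr ⟨by simpa using h, Or.inr ⟨u, a ++ [true], b ++ [true], by simp, by simp⟩⟩

theorem vertexKey_rightChild_lt_iff {v w : List Bool} :
    vertexKey (v ++ [true]) < vertexKey (w ++ [true]) ↔ vertexKey v < vertexKey w := by
  refine ⟨fun h => ?_, vertexKey_rightChild_strictMono⟩
  by_contra! h'
  rcases h'.eq_or_lt with h' | h'
  · rw [vertexKey_injective h'] at h
    exact h.false
  · exact (h.trans (vertexKey_rightChild_strictMono h')).false

theorem vertexKey_rightChild_le_iff {v w : List Bool} :
    vertexKey (v ++ [true]) ≤ vertexKey (w ++ [true]) ↔ vertexKey v ≤ vertexKey w := by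
  rw [← not_lt, vertexKey_rightChild_lt_iff, not_lt]

/-- The left child of a vertex is its immediate successor. -/
theorem vertexKey_leftChild_le_iff {v w : List Bool} :
    vertexKey (v ++ [false]) ≤ vertexKey w ↔ vertexKey v < vertexKey w := by
  refine ⟨(vertexKey_lt_append_singleton v false).trans_le, fun h => ?_⟩
  rw [← vertexPrec_iff] at h
  rw [← vertexPreceq_iff]
  rcases h with h | ⟨h, ⟨⟨s, rfl⟩, hne⟩ | ⟨u, a, b, rfl, rfl⟩⟩
  · exact Or.inr (Or.inl (by simpa using h))
  · obtain ⟨t, rfl⟩ := List.eq_cons_false_of_count_append_eq (by rintro rfl; simp at hne) h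
    by_cases ht : t = []
    · exact Or.inl (by rw [ht])
    · exact Or.inr (Or.inr ⟨by simpa using h, Or.inl ⟨⟨t, by simp⟩, by simpa using ht⟩⟩)
  · exact Or.inr (Or.inr ⟨by simpa using h, Or.inr ⟨u, a ++ [false], b, by simp, rfl⟩⟩)

/-- Nothing lies strictly between `w` and its left child, and a right child is never a left child.
-/
theorem vertexKey_rightChild_le_leftChild_iff {v w : List Bool} :
    vertexKey (v ++ [true]) ≤ vertexKey (w ++ [false]) ↔ vertexKey (v ++ [true]) ≤ vertexKey w := by
  constructor
  · intro h
    have hne : vertexKey (v ++ [true]) ≠ vertexKey (w ++ [false]) := by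
      rw [vertexKey_injective.ne_iff]
      intro h
      simpa using congrArg List.getLast? h
    by_contra! h'
    exact (hne.lt_of_le h).not_ge (vertexKey_leftChild_le_iff.2 h')
  · exact fun h => h.trans (vertexKey_lt_append_singleton w false).le

/-! ### From a tree to a point -/

/-- `p` satisfies the conditions of the theorem, for the vertices `w i` and the set `C` of captive
nodes. -/
def Realizes {ι : Type*} (w : ι → List Bool) (C : Set (List Bool)) (p : ι → ℝ) : Prop :=
  (∀ i j, p i ≤ p j ↔ vertexKey (w i) ≤ vertexKey (w j)) ∧
    (∀ i j, p i < p j + 1 ↔ vertexKey (w i) < vertexKey (w j ++ [true])) ∧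
    (∀ i j, p i = p j + 1 ↔ w i = w j ++ [true] ∧ w i ∈ C)

/-- Induction step of `exists_heights`: `x` is the height of a new vertex `a` above all earlier
ones. -/
theorem exists_height_of_max (C : Set (List Bool)) (s : Finset (List Bool)) (q : List Bool → ℝ)
    (hq1 : ∀ u ∈ s, ∀ v ∈ s, (q u ≤ q v ↔ vertexKey u ≤ vertexKey v))
    (hq2 : ∀ u ∈ s, ∀ v ∈ s, (q u < q v + 1 ↔ vertexKey u < vertexKey (v ++ [true])))
    (a : List Bool) (ha : ∀ u ∈ s, vertexKey u < vertexKey a)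
    (hC : a ∈ C → ∃ v ∈ s, a = v ++ [true]) :
    ∃ x, (∀ y ∈ s, q y < x) ∧ (∀ z ∈ s, x < q z + 1 ↔ vertexKey a < vertexKey (z ++ [true])) ∧
      ∀ z ∈ s, x = q z + 1 ↔ a = z ++ [true] ∧ a ∈ C := by
  classical
  have hlt : ∀ u ∈ s, ∀ v ∈ s, (q u < q v ↔ vertexKey u < vertexKey v) := fun u hu v hv => by
    rw [← not_le, hq1 v hv u hu, not_le]
  by_cases haC : a ∈ C
  · obtain ⟨v, hv, rfl⟩ := hC haC
    refine ⟨q v + 1, fun y hy => (hq2 y hy v hv).2 (ha y hy), fun z hz => ?_, fun z hz => ?_⟩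
    · rw [add_lt_add_iff_right, hlt v hv z hz, vertexKey_rightChild_lt_iff]
    · have : q v = q z ↔ v = z := by
        rw [le_antisymm_iff, hq1 v hv z hz, hq1 z hz v hv, ← le_antisymm_iff,
          vertexKey_injective.eq_iff]
      simp [haC, this]
  -- For a free vertex, all requirements are strict bounds: above the old heights and every `q z +
  -- 1` whose right-child position is at most `a`, below the other `q z + 1`. Every lower bound is
  -- less than every upper one.
  · obtain ⟨x, hx1, hx2⟩ := Order.exists_between_finsets
      (s.image q ∪ (s.filter fun z => vertexKey (z ++ [true]) ≤ vertexKey a).image (q · + 1))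
      ((s.filter fun z => vertexKey a < vertexKey (z ++ [true])).image (q · + 1)) (by
        intro l hl u hu
        simp only [Finset.mem_union, Finset.mem_image, Finset.mem_filter] at hl hu
        obtain ⟨z, ⟨hz, hz'⟩, rfl⟩ := hu
        rcases hl with ⟨y, hy, rfl⟩ | ⟨y, ⟨hy, hy'⟩, rfl⟩
        · exact (hq2 y hy z hz).2 ((ha y hy).trans hz')
        · have := hy'.trans_lt hz'
          rw [vertexKey_rightChild_lt_iff, ← hlt y hy z hz] at this
          linarith)
    simp only [Finset.mem_union, Finset.mem_image, Finset.mem_filter] at hx1 hx2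
    have h1 : ∀ z ∈ s, vertexKey a < vertexKey (z ++ [true]) → x < q z + 1 :=
      fun z hz h => hx2 _ ⟨z, ⟨hz, h⟩, rfl⟩
    have h2 : ∀ z ∈ s, vertexKey (z ++ [true]) ≤ vertexKey a → q z + 1 < x :=
      fun z hz h => hx1 _ (Or.inr ⟨z, ⟨hz, h⟩, rfl⟩)
    refine ⟨x, fun y hy => hx1 _ (Or.inl ⟨y, hy, rfl⟩), fun z hz => ⟨fun h => ?_, h1 z hz⟩,
      fun z hz => ⟨fun h => ?_, fun h => absurd h.2 haC⟩⟩
    · by_contra! h'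
      exact (h.trans (h2 z hz h')).false
    · rcases lt_or_ge (vertexKey a) (vertexKey (z ++ [true])) with h' | h'
      · exact absurd h (h1 z hz h').ne
      · exact absurd h (h2 z hz h').ne'

theorem exists_heights (C : Set (List Bool)) (S : Finset (List Bool))
    (hC : ∀ u ∈ S, u ∈ C → ∃ v ∈ S, u = v ++ [true]) :
    ∃ q : List Bool → ℝ, ∀ u ∈ S, ∀ v ∈ S, (q u ≤ q v ↔ vertexKey u ≤ vertexKey v) ∧
      (q u < q v + 1 ↔ vertexKey u < vertexKey (v ++ [true])) ∧
      (q u = q v + 1 ↔ u = v ++ [true] ∧ u ∈ C) := by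
  classical
  induction S using Finset.induction_on_max_value vertexKey with
  | empty => exact ⟨0, by simp⟩
  | insert a s has hmax ih =>
    have ha : ∀ u ∈ s, vertexKey u < vertexKey a := fun u hu =>
      (hmax u hu).lt_of_ne fun h => has (vertexKey_injective h ▸ hu)
    -- The parent of a captive vertex is not the maximal `a`, since its child would come later
    -- still.
    have hs : ∀ u ∈ insert a s, u ∈ C → ∃ v ∈ s, u = v ++ [true] := by
      intro u hu huC
      obtain ⟨v, hv, rfl⟩ := hC u hu huC
      rcases Finset.mem_insert.1 hv with rfl | hv
      · have h := vertexKey_lt_append_singleton v true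
        rcases Finset.mem_insert.1 hu with hu | hu
        · simp at hu
        · exact absurd (h.trans (ha _ hu)) (lt_irrefl _)
      · exact ⟨v, hv, rfl⟩
    obtain ⟨q, hq⟩ := ih fun u hu => hs u (Finset.mem_insert_of_mem hu)
    obtain ⟨x, hx1, hx2, hx3⟩ := exists_height_of_max C s q (fun u hu v hv => (hq u hu v hv).1)
      (fun u hu v hv => (hq u hu v hv).2.1) a ha (hs a (Finset.mem_insert_self a s))
    have hne : ∀ u ∈ s, u ≠ a := fun u hu h => has (h ▸ hu)
    refine ⟨Function.update q a x, fun u hu v hv => ?_⟩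
    rcases Finset.mem_insert.1 hu with rfl | hu' <;> rcases Finset.mem_insert.1 hv with rfl | hv'
    · simp [vertexKey_lt_append_singleton]
    · rw [Function.update_self, Function.update_of_ne (hne v hv')]
      exact ⟨iff_of_false (hx1 v hv').not_ge (ha v hv').not_ge, hx2 v hv', hx3 v hv'⟩
    · rw [Function.update_self, Function.update_of_ne (hne u hu')]
      have h1 := hx1 u hu'
      have h2 := ha u hu'
      refine ⟨by simp [h1.le, h2.le], ?_, ?_⟩
      · exact iff_of_true (by linarith) (h2.trans (vertexKey_lt_append_singleton v true))
      · refine ⟨fun h => by linarith, fun h => ?_⟩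
        rw [h.1] at h2
        exact absurd (h2.trans (vertexKey_lt_append_singleton v true)) (lt_irrefl _)
    · rw [Function.update_of_ne (hne v hv'), Function.update_of_ne (hne u hu')]
      exact hq u hu' v hv'

theorem exists_realizes {ι : Type*} [Finite ι] (w : ι → List Bool) (C : Set (List Bool))
    (hC : ∀ i, w i ∈ C → ∃ j, w i = w j ++ [true]) : ∃ p, Realizes w C p := by
  obtain ⟨q, hq⟩ := exists_heights C (Set.finite_range w).toFinset (by
    simpa using hC)
  simp only [Set.Finite.mem_toFinset, Set.forall_mem_range] at hq
  exact ⟨q ∘ w, fun i j => (hq i j).1, fun i j => (hq i j).2.1, fun i j => (hq i j).2.2⟩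

/-! ### From a point to words -/

theorem exists_word_of_max (s : Finset ℝ) (w : ℝ → List Bool)
    (hw1 : ∀ a ∈ s, ∀ b ∈ s, (a ≤ b ↔ vertexKey (w a) ≤ vertexKey (w b)))
    (hw2 : ∀ a ∈ s, ∀ b ∈ s, (a < b + 1 ↔ vertexKey (w a) < vertexKey (w b ++ [true])))
    (x : ℝ) (hx : ∀ a ∈ s, a < x) :
    ∃ W, (∀ a ∈ s, vertexKey (w a) < vertexKey W) ∧
      (∀ a ∈ s, x < a + 1 ↔ vertexKey W < vertexKey (w a ++ [true])) ∧
      (∀ a ∈ s, x = a + 1 → W = w a ++ [true]) ∧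
      ∀ u b, W = u ++ [b] → ∃ a ∈ s, w a = u := by
  classical
  rcases s.eq_empty_or_nonempty with rfl | hs
  · exact ⟨[], by simp⟩
  obtain ⟨y, hy, hmax⟩ := s.exists_max_image id hs
  simp only [id] at hmax
  -- Does some `z + 1` separate the old maximum `y` from `x`, or equal `x`?
  by_cases hz : ∃ z ∈ s, y < z + 1 ∧ z + 1 ≤ x
  · obtain ⟨z, hz, hyz, hzx⟩ := hz
    obtain ⟨m, hm, hmmax⟩ := (s.filter fun z => z + 1 ≤ x).exists_max_image id
      ⟨z, Finset.mem_filter.2 ⟨hz, hzx⟩⟩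
    simp only [id, Finset.mem_filter] at hm hmmax
    have hzm := hmmax z ⟨hz, hzx⟩
    refine ⟨w m ++ [true], fun a ha => (hw2 a ha m hm.1).1 (by linarith [hmax a ha]),
      fun a ha => ?_, fun a ha h => ?_, fun u b h => ?_⟩
    · rw [vertexKey_rightChild_lt_iff, ← not_le, ← not_le, not_iff_not, ← hw1 a ha m hm.1]
      exact ⟨fun h => hmmax a ⟨ha, h⟩, fun h => by linarith⟩
    · have := hmmax a ⟨ha, h.ge⟩
      rw [show m = a by linarith]
    · exact ⟨m, hm.1, (List.append_inj' h rfl).1⟩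
  · push Not at hz
    refine ⟨w y ++ [false], fun a ha => ((hw1 a ha y hy).1 (hmax a ha)).trans_lt
      (vertexKey_lt_append_singleton _ _), fun a ha => ?_, fun a ha h => ?_, fun u b h => ?_⟩
    · have hya : vertexKey (w a ++ [true]) ≤ vertexKey (w y) ↔ a + 1 ≤ y := by
        rw [← not_lt, ← hw2 y hy a ha, not_lt]
      rw [← not_iff_not, not_lt, not_lt, vertexKey_rightChild_le_leftChild_iff, hya]
      refine ⟨fun h => ?_, fun h => h.trans (hx y hy).le⟩
      by_contra! h'
      exact (hz a ha h').not_ge h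
    · exact absurd h (hz a ha (by linarith [hx y hy])).ne
    · exact ⟨y, hy, (List.append_inj' h rfl).1⟩

theorem exists_words (Q : Finset ℝ) :
    ∃ w : ℝ → List Bool, (∀ a ∈ Q, ∀ b ∈ Q, (a ≤ b ↔ vertexKey (w a) ≤ vertexKey (w b)) ∧
        (a < b + 1 ↔ vertexKey (w a) < vertexKey (w b ++ [true])) ∧
        (a = b + 1 → w a = w b ++ [true])) ∧
      ∀ a ∈ Q, ∀ u b, w a = u ++ [b] → ∃ c ∈ Q, w c = u := by
  classical
  induction Q using Finset.induction_on_max with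
  | empty => exact ⟨fun _ => [], by simp⟩
  | insert x s hx ih =>
    obtain ⟨w, hw, hpre⟩ := ih
    obtain ⟨W, hW1, hW2, hW3, hW4⟩ := exists_word_of_max s w (fun a ha b hb => (hw a ha b hb).1)
      (fun a ha b hb => (hw a ha b hb).2.1) x hx
    have hne : ∀ a ∈ s, a ≠ x := fun a ha => (hx a ha).ne
    refine ⟨Function.update w x W, fun a ha b hb => ?_, fun a ha u b h => ?_⟩
    · rcases Finset.mem_insert.1 ha with rfl | ha' <;> rcases Finset.mem_insert.1 hb with rfl | hb'
      · simp [vertexKey_lt_append_singleton]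
      · rw [Function.update_self, Function.update_of_ne (hne b hb')]
        exact ⟨iff_of_false (hx b hb').not_ge (hW1 b hb').not_ge, hW2 b hb', hW3 b hb'⟩
      · rw [Function.update_self, Function.update_of_ne (hne a ha')]
        have h1 := hx a ha'
        have h2 := hW1 a ha'
        refine ⟨by simp [h1.le, h2.le], ?_, fun h => by linarith⟩
        exact iff_of_true (by linarith) (h2.trans (vertexKey_lt_append_singleton W true))
      · rw [Function.update_of_ne (hne a ha'), Function.update_of_ne (hne b hb')]
        exact hw a ha' b hb'
    · have : ∃ c ∈ s, w c = u := by
        rcases Finset.mem_insert.1 ha with rfl | ha'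
        · rw [Function.update_self] at h
          exact hW4 u b h
        · rw [Function.update_of_ne (hne a ha')] at h
          exact hpre a ha' u b h
      obtain ⟨c, hc, hcu⟩ := this
      exact ⟨c, Finset.mem_insert_of_mem hc, by rwa [Function.update_of_ne (hne c hc)]⟩

/-! ### Uniqueness of the words -/

theorem Realizes.eq_iff {ι : Type*} {w : ι → List Bool} {C : Set (List Bool)} {p : ι → ℝ}
    (h : Realizes w C p) (i j : ι) : p i = p j ↔ w i = w j := by
  rw [le_antisymm_iff, h.1, h.1, ← le_antisymm_iff, vertexKey_injective.eq_iff]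

theorem Realizes.lt_iff {ι : Type*} {w : ι → List Bool} {C : Set (List Bool)} {p : ι → ℝ}
    (h : Realizes w C p) (i j : ι) : p i < p j ↔ vertexKey (w i) < vertexKey (w j) := by
  rw [← not_le, h.1, not_le]

theorem Realizes.add_one_le_iff {ι : Type*} {w : ι → List Bool} {C : Set (List Bool)} {p : ι → ℝ}
    (h : Realizes w C p) (i j : ι) :
    p j + 1 ≤ p i ↔ vertexKey (w j ++ [true]) ≤ vertexKey (w i) := by
  rw [← not_lt, h.2.1, not_lt]

theorem exists_realizes_words {ι : Type*} [Finite ι] (p : ι → ℝ) :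
    ∃ (w : ι → List Bool) (C : Set (List Bool)), Realizes w C p ∧
      (∀ i u b, w i = u ++ [b] → ∃ j, w j = u) ∧ ∀ u ∈ C, ∃ i j, u = w i ∧ u = w j ++ [true] := by
  obtain ⟨w, hw, hpre⟩ := exists_words (Set.finite_range p).toFinset
  simp only [Set.Finite.mem_toFinset, Set.forall_mem_range, Set.exists_range_iff] at hw hpre
  have hinj : ∀ i j, w (p i) = w (p j) ↔ p i = p j := fun i j => by
    rw [le_antisymm_iff (a := p i), (hw i j).1, (hw j i).1, ← le_antisymm_iff,
      vertexKey_injective.eq_iff]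
  -- `exists_words` gives only one direction of condition 3; the converse is obtained by taking as
  -- captive exactly the words witnessing a difference of one.
  refine ⟨w ∘ p, {u | ∃ i j, u = w (p i) ∧ p i = p j + 1}, ⟨fun i j => (hw i j).1,
    fun i j => (hw i j).2.1, fun i j => ⟨fun h => ⟨(hw i j).2.2 h, i, j, rfl, h⟩, ?_⟩⟩, hpre, ?_⟩
  · rintro ⟨h, i', j', h1, h2⟩
    simp only [Function.comp] at h h1
    have h3 := (hw i' j').2.2 h2
    rw [← h1, h] at h3
    rw [(hinj i i').1 h1, h2, (hinj j j').1 (List.append_inj' h3 rfl).1]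
  · rintro u ⟨i, j, rfl, h⟩
    exact ⟨i, j, rfl, (hw i j).2.2 h⟩

/-- Strong induction on the value `p i`: the values determine on which side of its parent `w i`
hangs and the value of that parent, whose word is known by induction. -/
theorem Realizes.word_unique {ι : Type*} [Finite ι] {w w' : ι → List Bool}
    {C C' : Set (List Bool)} {p : ι → ℝ}
    (h : Realizes w C p) (h' : Realizes w' C' p)
    (hw : ∀ i u b, w i = u ++ [b] → ∃ j, w j = u)
    (hw' : ∀ i u b, w' i = u ++ [b] → ∃ j, w' j = u) : w = w' := by
  have hroot : ∀ {w : ι → List Bool} {C : Set (List Bool)}, Realizes w C p →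
      (∀ i u b, w i = u ++ [b] → ∃ j, w j = u) → ∀ i, (∀ j, p i ≤ p j) → w i = [] := by
    intro w C h hw i hi
    rcases List.eq_nil_or_concat (w i) with h0 | ⟨u, b, hu⟩
    · exact h0
    · rw [List.concat_eq_append] at hu
      obtain ⟨j, rfl⟩ := hw i u b hu
      have := (h.1 i j).1 (hi j)
      rw [hu] at this
      exact absurd this (vertexKey_lt_append_singleton _ _).not_ge
  have hnil : ∀ {w : ι → List Bool} {C : Set (List Bool)}, Realizes w C p →
      ∀ i, w i = [] → ∀ j, p i ≤ p j := by
    intro w C h i hi j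
    rw [h.1, hi, ← vertexPreceq_iff]
    by_cases hj : w j = []
    · exact Or.inl hj.symm
    · right
      by_cases hc : (w j).count true = 0
      · exact Or.inr ⟨by simp [hc], Or.inl ⟨List.nil_prefix, fun h => hj h.symm⟩⟩
      · exact Or.inl (by simpa using Nat.pos_of_ne_zero hc)
  -- As a right child, `i` gives `p j' + 1 ≤ p i`, hence `p j' + 1 ≤ p j` because `i` immediately
  -- follows `j` in `w`; but `p j < p i` forces `p j < p j' + 1`.
  have mixed : ∀ {w w' : ι → List Bool} {C C' : Set (List Bool)}, Realizes w C p →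
      Realizes w' C' p → ∀ i j j', w i = w j ++ [false] → w' i = w' j' ++ [true] → False := by
    intro w w' C C' h h' i j j' hj hj'
    have h1 := (h'.add_one_le_iff i j').2 (by rw [hj'])
    rw [h.add_one_le_iff, hj, vertexKey_rightChild_le_leftChild_iff, ← h.add_one_le_iff] at h1
    have h2 := (h.lt_iff j i).2 (by rw [hj]; exact vertexKey_lt_append_singleton _ _)
    rw [h'.lt_iff, hj', ← h'.2.1] at h2
    linarith
  -- The parent of a left child carries the largest value below `p i`.
  have leftLe : ∀ {w w' : ι → List Bool} {C C' : Set (List Bool)}, Realizes w C p →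
      Realizes w' C' p → ∀ i j j', w i = w j ++ [false] → w' i = w' j' ++ [false] → p j' ≤ p j := by
    intro w w' C C' h h' i j j' hj hj'
    by_contra! h1
    have h2 := (h'.lt_iff j' i).2 (by rw [hj']; exact vertexKey_lt_append_singleton _ _)
    rw [h.lt_iff, hj] at h2
    exact h2.not_ge (vertexKey_leftChild_le_iff.2 ((h.lt_iff _ _).1 h1))
  -- The parent of a right child carries the largest value `m` with `m + 1 ≤ p i`.
  have rightLe : ∀ {w w' : ι → List Bool} {C C' : Set (List Bool)}, Realizes w C p →
      Realizes w' C' p → ∀ i j j', w i = w j ++ [true] → w' i = w' j' ++ [true] → p j' ≤ p j := by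
    intro w w' C C' h h' i j j' hj hj'
    have h1 := (h'.add_one_le_iff i j').2 (by rw [hj'])
    rwa [h.add_one_le_iff, hj, vertexKey_rightChild_le_iff, ← h.1] at h1
  funext i
  have wf : WellFounded fun i j : ι => p i < p j := by
    have : IsTrans ι fun i j => p i < p j := ⟨fun _ _ _ => lt_trans⟩
    have : Std.Irrefl fun i j : ι => p i < p j := ⟨fun _ => lt_irrefl _⟩
    exact Finite.wellFounded_of_trans_of_irrefl _
  induction i using wf.induction with
  | _ i ih =>
  rcases List.eq_nil_or_concat (w i) with h0 | ⟨u, b, hu⟩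
  · rw [h0, hroot h' hw' i (hnil h i h0)]
  rcases List.eq_nil_or_concat (w' i) with h0 | ⟨u', b', hu'⟩
  · rw [h0, hroot h hw i (hnil h' i h0)]
  rw [List.concat_eq_append] at hu hu'
  obtain ⟨j, rfl⟩ := hw i u b hu
  obtain ⟨j', rfl⟩ := hw' i u' b' hu'
  have hlt : p j < p i := (h.lt_iff j i).2 (by rw [hu]; exact vertexKey_lt_append_singleton _ _)
  have key : p j = p j' → b = b' → w i = w' i := by
    rintro h1 rfl
    rw [hu, hu', ih j hlt, (h'.eq_iff j j').1 h1]
  cases b <;> cases b'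
  · exact key (le_antisymm (leftLe h' h i j' j hu' hu) (leftLe h h' i j j' hu hu')) rfl
  · exact (mixed h h' i j j' hu hu').elim
  · exact (mixed h' h i j' j hu' hu).elim
  · exact key (le_antisymm (rightLe h' h i j' j hu' hu) (rightLe h h' i j j' hu hu')) rfl

/-! ### Dimension of a face -/

/-- Removes from a word the letters that end the paths to vertices in `C`. -/
noncomputable def stripCaptive (C : Set (List Bool)) (w : List Bool) : List Bool :=
  open Classical in if w ∈ C ∧ w ≠ [] then stripCaptive C w.dropLast else w
termination_by w.length
decreasing_by
  rename_i h
  have := List.length_pos_iff.2 h.2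
  simp only [List.length_dropLast]; omega

theorem stripCaptive_of_notMem {C : Set (List Bool)} {w : List Bool} (h : w ∉ C) :
    stripCaptive C w = w := by
  rw [stripCaptive, if_neg (fun h' => h h'.1)]

theorem stripCaptive_append {C : Set (List Bool)} {w : List Bool} {b : Bool} (h : w ++ [b] ∈ C) :
    stripCaptive C (w ++ [b]) = stripCaptive C w := by
  rw [stripCaptive, if_pos ⟨h, by simp⟩, List.dropLast_concat]

/-- Tight equations persist on the whole face, which bounds the direction from above. Conversely,
moving `p` slightly along such a `d` keeps the strict signs by continuity. -/
theorem direction_affineSpan_sign {ι : Type*} [Finite ι] (p : ι → ℝ) :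
    ((affineSpan ℝ {x : ι → ℝ | ∀ (i j : ι) (s : Fin 2),
      SignType.sign (x i - x j - ((s : ℕ) : ℝ)) = SignType.sign (p i - p j - ((s : ℕ) : ℝ))}).direction
        : Set (ι → ℝ)) =
      {d | ∀ (i j : ι) (s : Fin 2), p i - p j - ((s : ℕ) : ℝ) = 0 → d i = d j} := by
  set F := {x : ι → ℝ | ∀ (i j : ι) (s : Fin 2),
      SignType.sign (x i - x j - ((s : ℕ) : ℝ)) = SignType.sign (p i - p j - ((s : ℕ) : ℝ))} with hF
  let V : Submodule ℝ (ι → ℝ) :=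
    { carrier := {d | ∀ (i j : ι) (s : Fin 2), p i - p j - ((s : ℕ) : ℝ) = 0 → d i = d j}
      add_mem' := fun ha hb i j s h => by simp [ha i j s h, hb i j s h]
      zero_mem' := fun i j s h => rfl
      smul_mem' := fun c d hd i j s h => by simp [hd i j s h] }
  suffices h : (affineSpan ℝ F).direction = V by rw [h]; rfl
  have hpF : p ∈ F := fun i j s => rfl
  apply le_antisymm
  · rw [direction_affineSpan, vectorSpan, Submodule.span_le]
    rintro _ ⟨x, hx, y, hy, rfl⟩ i j s h
    have h1 := hx i j s
    have h2 := hy i j s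
    rw [h, sign_zero, sign_eq_zero_iff] at h1 h2
    simp only [vsub_eq_sub, Pi.sub_apply]
    linarith
  · intro d hd
    have hev : ∀ᶠ e : ℝ in nhds 0, ∀ (i j : ι) (s : Fin 2),
        SignType.sign ((p + e • d) i - (p + e • d) j - ((s : ℕ) : ℝ)) =
          SignType.sign (p i - p j - ((s : ℕ) : ℝ)) := by
      simp only [Filter.eventually_all]
      intro i j s
      have hc : Filter.Tendsto (fun e : ℝ => (p + e • d) i - (p + e • d) j - ((s : ℕ) : ℝ)) (nhds 0)
          (nhds (p i - p j - ((s : ℕ) : ℝ))) := by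
        have : Continuous fun e : ℝ => (p + e • d) i - (p + e • d) j - ((s : ℕ) : ℝ) := by
          simp only [Pi.add_apply, Pi.smul_apply, smul_eq_mul]
          fun_prop
        simpa using this.tendsto 0
      rcases lt_trichotomy (p i - p j - ((s : ℕ) : ℝ)) 0 with h | h | h
      · filter_upwards [hc.eventually_lt_const h] with e he
        rw [sign_neg he, sign_neg h]
      · refine Filter.Eventually.of_forall fun e => ?_
        have := hd i j s h
        simp only [Pi.add_apply, Pi.smul_apply, this, smul_eq_mul]
        congr 1
        ring
      · filter_upwards [hc.eventually_const_lt h] with e he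
        rw [sign_pos he, sign_pos h]
    obtain ⟨e, he, he0⟩ := ((hev.filter_mono nhdsWithin_le_nhds).and
      (self_mem_nhdsWithin : {(0 : ℝ)}ᶜ ∈ nhdsWithin 0 {(0 : ℝ)}ᶜ)).exists
    have h1 := AffineSubspace.vsub_mem_direction (subset_affineSpan ℝ F he)
      (subset_affineSpan ℝ F hpF)
    rw [vsub_eq_sub, add_sub_cancel_left] at h1
    exact (Submodule.smul_mem_iff _ he0).1 h1

/-- The direction consists of the functions constant on the fibres of `r`, which sends an index to
the free node heading its dashed chain; its dimension is the number of values of `r`. -/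
theorem Realizes.finrank_direction {ι : Type*} [Finite ι] {w : ι → List Bool}
    {C : Set (List Bool)} {p : ι → ℝ} (h : Realizes w C p)
    (hC : ∀ i, w i ∈ C → ∃ j, w i = w j ++ [true]) :
    Module.finrank ℝ (affineSpan ℝ {x : ι → ℝ | ∀ (i j : ι) (s : Fin 2),
      SignType.sign (x i - x j - ((s : ℕ) : ℝ)) =
        SignType.sign (p i - p j - ((s : ℕ) : ℝ))}).direction = (Set.range w \ C).ncard := by
  set A := (affineSpan ℝ {x : ι → ℝ | ∀ (i j : ι) (s : Fin 2),
      SignType.sign (x i - x j - ((s : ℕ) : ℝ)) =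
        SignType.sign (p i - p j - ((s : ℕ) : ℝ))}).direction
  have hA : (A : Set (ι → ℝ)) = _ := direction_affineSpan_sign p
  have hstrip : ∀ (m : ℕ) (i : ι), (w i).length = m → ∃ j, stripCaptive C (w i) = w j ∧ w j ∉ C ∧
      ∀ d ∈ A, d i = d j := by
    intro m
    induction m with
    | zero =>
      intro i hi
      have : w i ∉ C := fun h' => by
        obtain ⟨j, hj⟩ := hC i h'
        simp [hj] at hi
      exact ⟨i, stripCaptive_of_notMem this, this, fun _ _ => rfl⟩
    | succ m ih =>
      intro i hi
      by_cases hiC : w i ∈ C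
      · obtain ⟨j, hj⟩ := hC i hiC
        obtain ⟨k, hk1, hk2, hk3⟩ := ih j (by simpa [hj] using hi)
        refine ⟨k, ?_, hk2, fun d hd => ?_⟩
        · rw [hj, stripCaptive_append (hj ▸ hiC), hk1]
        · have hd' := hd
          rw [← SetLike.mem_coe, hA] at hd'
          rw [← hk3 d hd]
          refine hd' i j 1 ?_
          have := (h.2.2 i j).2 ⟨hj, hiC⟩
          simp [this]
      · exact ⟨i, stripCaptive_of_notMem hiC, hiC, fun _ _ => rfl⟩
  let r : ι → (Set.range w \ C : Set (List Bool)) := fun i => ⟨stripCaptive C (w i), by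
    obtain ⟨j, hj, hj', -⟩ := hstrip _ i rfl
    rw [hj]
    exact ⟨⟨j, rfl⟩, hj'⟩⟩
  have hr : Function.Surjective r := by
    rintro ⟨_, ⟨i, rfl⟩, hi⟩
    exact ⟨i, Subtype.ext (stripCaptive_of_notMem hi)⟩
  have hrange : LinearMap.range (LinearMap.funLeft ℝ ℝ r) = A := by
    apply SetLike.coe_injective
    ext d
    constructor
    · rintro ⟨g, rfl⟩
      rw [hA]
      intro i j s hs
      rw [LinearMap.funLeft_apply, LinearMap.funLeft_apply]
      congr 1
      apply Subtype.ext
      change stripCaptive C (w i) = stripCaptive C (w j)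
      match s with
      | 0 => rw [(h.eq_iff i j).1 (by simpa [sub_eq_zero] using hs)]
      | 1 =>
        obtain ⟨h1, h2⟩ := (h.2.2 i j).1 (by simp at hs; linarith)
        rw [h1, stripCaptive_append (h1 ▸ h2)]
    · intro hd
      refine ⟨fun u => d (Function.surjInv hr u), funext fun i => ?_⟩
      rw [LinearMap.funLeft_apply]
      obtain ⟨j, hj, -, hj'⟩ := hstrip _ i rfl
      obtain ⟨k, hk, -, hk'⟩ := hstrip _ (Function.surjInv hr (r i)) rfl
      have h1 : stripCaptive C (w (Function.surjInv hr (r i))) = stripCaptive C (w i) :=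
        congrArg Subtype.val (Function.surjInv_eq hr (r i))
      have h2 : p j - p k - (((0 : Fin 2) : ℕ) : ℝ) = 0 := by
        have : p j = p k := (h.eq_iff j k).2 (by rw [← hj, ← hk, h1])
        simp [this]
      have hd' := hd
      rw [hA] at hd'
      rw [hj' d hd, hk' d hd, hd' j k 0 h2]
  have : Finite (Set.range w \ C : Set (List Bool)) := ((Set.finite_range w).sdiff).to_subtype
  have := Fintype.ofFinite (Set.range w \ C : Set (List Bool))
  rw [← hrange, LinearMap.finrank_range_of_inj (LinearMap.funLeft_injective_of_surjective ℝ ℝ r hr),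
    Module.finrank_fintype_fun_eq_card, ← Nat.card_eq_fintype_card, Nat.card_coe_set_eq]

/-! ### Trees and their words -/

namespace LabeledTree

variable {n : ℕ}

theorem subtreeAt_append (t : LabeledTree n) (u v : List Bool) :
    t.subtreeAt (u ++ v) = (t.subtreeAt u).bind fun s => s.subtreeAt v := by
  induction u generalizing t with
  | nil => simp [subtreeAt]
  | cons b u ih => cases t <;> cases b <;> simp [subtreeAt, ih]

theorem IsNode.of_append {t : LabeledTree n} {u : List Bool} {b : Bool} {A : Finset (Fin n)}
    (h : t.IsNode (u ++ [b]) A) : ∃ B, t.IsNode u B := by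
  obtain ⟨d, l, r, h⟩ := h
  rw [subtreeAt_append] at h
  rcases hu : t.subtreeAt u with _ | _ | ⟨B, e, l', r'⟩
  · simp [hu] at h
  · simp [hu, subtreeAt] at h
  · exact ⟨B, e, l', r', hu⟩

theorem IsNode.label_unique {t : LabeledTree n} {u : List Bool} {A B : Finset (Fin n)}
    (h : t.IsNode u A) (h' : t.IsNode u B) : A = B := by
  obtain ⟨d, l, r, h⟩ := h
  obtain ⟨d', l', r', h'⟩ := h'
  rw [h] at h'
  simp only [Option.some.injEq, node.injEq] at h'
  exact h'.1

theorem ext_of_subtreeAt {t t' : LabeledTree n}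
    (h : ∀ u A d, (∃ l r, t.subtreeAt u = some (node A d l r)) ↔
      ∃ l r, t'.subtreeAt u = some (node A d l r)) : t = t' := by
  induction t generalizing t' with
  | leaf =>
    cases t' with
    | leaf => rfl
    | node A d l r =>
      obtain ⟨l, r, h⟩ := (h [] A d).2 ⟨l, r, rfl⟩
      simp [subtreeAt] at h
  | node A d l r hl hr =>
    obtain ⟨l', r', h'⟩ := (h [] A d).1 ⟨l, r, rfl⟩
    simp only [subtreeAt, Option.some.injEq] at h'
    subst h'
    rw [hl fun u => h (false :: u), hr fun u => h (true :: u)]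

open Classical in
/-- The tree, up to depth `k`, with vertices in `Set.range w` as nodes, read from the vertex `u` on;
the edges above the vertices in `C` are dashed. -/
noncomputable def ofWords (w : Fin n → List Bool) (C : Set (List Bool)) :
    ℕ → List Bool → LabeledTree n
  | 0, _ => leaf
  | k + 1, u =>
    if u ∈ Set.range w then
      node (Finset.univ.filter fun i => w i = u) (decide (u ++ [true] ∈ C))
        (ofWords w C k (u ++ [false])) (ofWords w C k (u ++ [true]))
    else leaf

theorem subtreeAt_ofWords_eq_node {w : Fin n → List Bool} {C : Set (List Bool)} {k : ℕ}
    {u v : List Bool} {A : Finset (Fin n)} {d : Bool} {l r : LabeledTree n}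
    (h : (ofWords w C k u).subtreeAt v = some (node A d l r)) :
    u ++ v ∈ Set.range w ∧ (∀ i, i ∈ A ↔ w i = u ++ v) ∧ (d = true ↔ u ++ v ++ [true] ∈ C) := by
  classical
  induction k generalizing u v with
  | zero => cases v <;> simp [ofWords, subtreeAt] at h
  | succ k ih =>
    by_cases hu : u ∈ Set.range w
    · rw [ofWords, if_pos hu] at h
      rcases v with _ | ⟨_ | _, v⟩
      · simp only [subtreeAt, Option.some.injEq, node.injEq] at h
        obtain ⟨rfl, rfl, -⟩ := h
        simp only [List.append_nil]
        exact ⟨hu, by simp, by simp⟩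
      · simpa using ih h
      · simpa using ih h
    · rw [ofWords, if_neg hu] at h
      cases v <;> simp [subtreeAt] at h

theorem exists_subtreeAt_ofWords {w : Fin n → List Bool} {C : Set (List Bool)} {k : ℕ}
    (hw : ∀ i u b, w i = u ++ [b] → ∃ j, w j = u) {u v : List Bool} (hv : v.length < k)
    (h : u ++ v ∈ Set.range w) : ∃ A d l r, (ofWords w C k u).subtreeAt v = some (node A d l r) := by
  have hpre : ∀ s t : List Bool, s ++ t ∈ Set.range w → s ∈ Set.range w := by
    intro s t
    induction t using List.reverseRecOn with
    | nil => simp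
    | append_singleton t b ih =>
      rintro ⟨i, hi⟩
      exact ih (hw i (s ++ t) b (by rw [hi, List.append_assoc]))
  induction k generalizing u v with
  | zero => omega
  | succ k ih =>
    rw [ofWords, if_pos (hpre u v h)]
    rcases v with _ | ⟨_ | _, v⟩
    · exact ⟨_, _, _, _, rfl⟩
    · exact ih (by simpa using hv) (by simpa using h)
    · exact ih (by simpa using hv) (by simpa using h)

end LabeledTree

namespace DecoratedBinaryTree

variable {n : ℕ}

theorem exists_isNode_nodeOf (T : DecoratedBinaryTree n) (i : Fin n) :
    ∃ A, T.tree.IsNode (T.nodeOf i) A ∧ i ∈ A :=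
  (T.label_partition i).choose_spec.1

theorem nodeOf_eq {T : DecoratedBinaryTree n} {i : Fin n} {u : List Bool} {A : Finset (Fin n)}
    (h : T.tree.IsNode u A) (hi : i ∈ A) : T.nodeOf i = u :=
  ((T.label_partition i).choose_spec.2 u ⟨A, h, hi⟩).symm

theorem isNode_iff {T : DecoratedBinaryTree n} {u : List Bool} {A : Finset (Fin n)} :
    T.tree.IsNode u A ↔ u ∈ Set.range T.nodeOf ∧ ∀ i, i ∈ A ↔ T.nodeOf i = u := by
  have key : ∀ {B}, T.tree.IsNode u B → ∀ i, i ∈ B ↔ T.nodeOf i = u := by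
    refine fun {B} h i => ⟨nodeOf_eq h, ?_⟩
    rintro rfl
    obtain ⟨B', h', hi⟩ := T.exists_isNode_nodeOf i
    rwa [h.label_unique h']
  constructor
  · intro h
    obtain ⟨i, hi⟩ := T.label_nonempty u A h
    exact ⟨⟨i, nodeOf_eq h hi⟩, key h⟩
  · rintro ⟨⟨i, rfl⟩, h⟩
    obtain ⟨B, hB, -⟩ := T.exists_isNode_nodeOf i
    rwa [show A = B from Finset.ext fun j => by rw [h, key hB]]

theorem exists_isNode_iff {T : DecoratedBinaryTree n} {u : List Bool} :
    (∃ A, T.tree.IsNode u A) ↔ u ∈ Set.range T.nodeOf := by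
  classical
  simp only [isNode_iff, exists_and_left, and_iff_left_iff_imp]
  exact fun _ => ⟨Finset.univ.filter fun i => T.nodeOf i = u, by simp⟩

theorem exists_nodeOf_eq_of_append (T : DecoratedBinaryTree n) (i : Fin n) (u : List Bool)
    (b : Bool) (h : T.nodeOf i = u ++ [b]) : ∃ j, T.nodeOf j = u := by
  have := exists_isNode_iff.2 (Set.mem_range_self (f := T.nodeOf) i)
  rw [h] at this
  obtain ⟨A, hA⟩ := this
  exact exists_isNode_iff.1 hA.of_append

theorem isCaptive_append_true_iff {T : DecoratedBinaryTree n} {u : List Bool} :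
    T.IsCaptive (u ++ [true]) ↔ ∃ B l r, T.tree.subtreeAt u = some (.node B true l r) := by
  constructor
  · rintro ⟨-, v, B, l, r, h, hB⟩
    rw [(List.append_inj' h rfl).1]
    exact ⟨B, l, r, hB⟩
  · rintro ⟨B, l, r, h⟩
    refine ⟨?_, u, B, l, r, rfl, h⟩
    rcases r with _ | ⟨A, d, l', r'⟩
    · exact absurd h (T.dashed_internal u B l)
    · exact ⟨A, d, l', r', by simp [LabeledTree.subtreeAt_append, h, LabeledTree.subtreeAt]⟩

theorem IsCaptive.exists_nodeOf {T : DecoratedBinaryTree n} {u : List Bool} (h : T.IsCaptive u) :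
    ∃ j, u = T.nodeOf j ++ [true] := by
  obtain ⟨-, v, B, l, r, rfl, hB⟩ := h
  obtain ⟨j, rfl⟩ := exists_isNode_iff.1 ⟨B, true, l, r, hB⟩
  exact ⟨j, rfl⟩

theorem exists_subtreeAt_eq_node_iff {T : DecoratedBinaryTree n} {u : List Bool}
    {A : Finset (Fin n)} {d : Bool} :
    (∃ l r, T.tree.subtreeAt u = some (.node A d l r)) ↔
      (u ∈ Set.range T.nodeOf ∧ ∀ i, i ∈ A ↔ T.nodeOf i = u) ∧
        (d = true ↔ T.IsCaptive (u ++ [true])) := by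
  rw [← isNode_iff, isCaptive_append_true_iff]
  constructor
  · rintro ⟨l, r, h⟩
    refine ⟨⟨d, l, r, h⟩, ?_, ?_⟩
    · rintro rfl
      exact ⟨A, l, r, h⟩
    · rintro ⟨B, l', r', h'⟩
      rw [h] at h'
      simp only [Option.some.injEq, LabeledTree.node.injEq] at h'
      exact h'.2.1
  · rintro ⟨⟨e, l, r, h⟩, h'⟩
    have : d = e := by
      rw [Bool.eq_iff_iff, h']
      constructor
      · rintro ⟨B, l', r', h''⟩
        rw [h] at h''
        simp only [Option.some.injEq, LabeledTree.node.injEq] at h''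
        exact h''.2.1
      · rintro rfl
        exact ⟨A, l, r, h⟩
    exact ⟨l, r, this ▸ h⟩

theorem ext_of_nodeOf {T T' : DecoratedBinaryTree n} (h : T.nodeOf = T'.nodeOf)
    (hC : ∀ u, T.IsCaptive u ↔ T'.IsCaptive u) : T = T' := by
  have : T.tree = T'.tree := LabeledTree.ext_of_subtreeAt fun u A d => by
    rw [exists_subtreeAt_eq_node_iff, exists_subtreeAt_eq_node_iff, h, hC]
  cases T
  cases T'
  congr

theorem exists_of_words (w : Fin n → List Bool) (C : Set (List Bool))
    (hw : ∀ i u b, w i = u ++ [b] → ∃ j, w j = u)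
    (hC : ∀ u ∈ C, ∃ i j, u = w i ∧ u = w j ++ [true]) :
    ∃ T : DecoratedBinaryTree n, T.nodeOf = w ∧ ∀ u, T.IsCaptive u ↔ u ∈ C := by
  -- The depth `k` exceeds all word lengths, so truncation in `ofWords` loses no node.
  obtain ⟨k, hk⟩ : ∃ k, ∀ i, (w i).length < k := by
    obtain ⟨k, hk⟩ := (Set.finite_range fun i => (w i).length).bddAbove
    exact ⟨k + 1, fun i => Nat.lt_succ_of_le (hk ⟨i, rfl⟩)⟩
  have hnode : ∀ {v A d l r}, (LabeledTree.ofWords w C k []).subtreeAt v = some (.node A d l r) →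
      v ∈ Set.range w ∧ (∀ i, i ∈ A ↔ w i = v) ∧ (d = true ↔ v ++ [true] ∈ C) :=
    fun h => LabeledTree.subtreeAt_ofWords_eq_node h
  have hex : ∀ i, ∃ A d l r,
      (LabeledTree.ofWords w C k []).subtreeAt (w i) = some (.node A d l r) :=
    fun i => LabeledTree.exists_subtreeAt_ofWords hw (hk i) ⟨i, rfl⟩
  let T : DecoratedBinaryTree n :=
    { tree := LabeledTree.ofWords w C k []
      label_nonempty := by
        rintro u A ⟨d, l, r, h⟩
        obtain ⟨⟨i, hi⟩, hA, -⟩ := hnode h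
        exact ⟨i, (hA i).2 hi⟩
      label_partition := by
        intro i
        obtain ⟨A, d, l, r, h⟩ := hex i
        refine ⟨w i, ⟨A, ⟨d, l, r, h⟩, ((hnode h).2.1 i).2 rfl⟩, ?_⟩
        rintro u ⟨B, ⟨d', l', r', h'⟩, hi⟩
        exact (((hnode h').2.1 i).1 hi).symm
      dashed_internal := by
        intro u A l h
        obtain ⟨i, j, hi, -⟩ := hC _ ((hnode h).2.2.1 rfl)
        obtain ⟨A, d, l, r, h'⟩ := hex i
        rw [← hi] at h'
        simp [LabeledTree.subtreeAt_append, h, LabeledTree.subtreeAt] at h' }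
  have hT : T.nodeOf = w := funext fun i => by
    obtain ⟨A, d, l, r, h⟩ := hex i
    exact nodeOf_eq (T := T) ⟨d, l, r, h⟩ (((hnode h).2.1 i).2 rfl)
  refine ⟨T, hT, fun u => ⟨?_, fun hu => ?_⟩⟩
  · rintro ⟨-, v, B, l, r, rfl, h⟩
    exact (hnode h).2.2.1 rfl
  · obtain ⟨i, j, -, rfl⟩ := hC u hu
    obtain ⟨A, d, l, r, h⟩ := hex j
    have hd := (hnode h).2.2.2 hu
    subst hd
    exact isCaptive_append_true_iff.2 ⟨A, l, r, h⟩

/-! ### Trees and faces -/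

theorem mem_points_iff {T : DecoratedBinaryTree n} {p : Fin n → ℝ} :
    p ∈ T.points ↔ Realizes T.nodeOf {u | T.IsCaptive u} p := by
  simp only [points, Set.mem_ofPred_eq, Realizes, vertexPreceq_iff, vertexPrec_iff, rightChildOf]
  refine and_congr_right fun _ => and_congr_right fun _ => forall₂_congr fun i j => ?_
  exact iff_congr Iff.rfl (and_congr_right fun h => by rw [h])

theorem exists_mem_points (T : DecoratedBinaryTree n) : ∃ p, p ∈ T.points := by
  obtain ⟨p, hp⟩ := exists_realizes T.nodeOf {u | T.IsCaptive u} fun i hi =>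
    IsCaptive.exists_nodeOf hi
  exact ⟨p, mem_points_iff.2 hp⟩

theorem exists_points_mem (p : Fin n → ℝ) : ∃ T : DecoratedBinaryTree n, p ∈ T.points := by
  obtain ⟨w, C, h, hw, hC⟩ := exists_realizes_words p
  obtain ⟨T, rfl, hT⟩ := exists_of_words w C hw hC
  refine ⟨T, mem_points_iff.2 ?_⟩
  rwa [show {u | T.IsCaptive u} = C from Set.ext hT]

theorem eq_of_mem_points {T T' : DecoratedBinaryTree n} {p : Fin n → ℝ} (h : p ∈ T.points)
    (h' : p ∈ T'.points) : T = T' := by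
  have hw : T.nodeOf = T'.nodeOf := (mem_points_iff.1 h).word_unique (mem_points_iff.1 h')
    T.exists_nodeOf_eq_of_append T'.exists_nodeOf_eq_of_append
  have key : ∀ {T T' : DecoratedBinaryTree n}, p ∈ T.points → p ∈ T'.points →
      T.nodeOf = T'.nodeOf → ∀ u, T.IsCaptive u → T'.IsCaptive u := by
    intro T T' h h' hw u hu
    obtain ⟨i, rfl⟩ := exists_isNode_iff.1 hu.1
    obtain ⟨j, hj⟩ := hu.exists_nodeOf
    have := (h'.2.2 i j).1 ((h.2.2 i j).2 ⟨hj, by rwa [hj] at hu⟩)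
    rw [hw, this.1]
    exact this.2
  exact ext_of_nodeOf hw fun u => ⟨key h h' hw u, key h' h hw.symm u⟩

/-- The tree fixes the truth value of every comparison, so another point satisfies the conditions
exactly when it compares as `p` does. -/
theorem points_eq_of_mem {T : DecoratedBinaryTree n} {p : Fin n → ℝ} (hp : p ∈ T.points) :
    T.points = {x | ∀ (i j : Fin n) (s : Fin 2), SignType.sign (x i - x j - ((s : ℕ) : ℝ)) =
      SignType.sign (p i - p j - ((s : ℕ) : ℝ))} := by
  have sign_eq : ∀ {a b : ℝ}, SignType.sign a = SignType.sign b ↔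
      (a ≤ 0 ↔ b ≤ 0) ∧ (0 ≤ a ↔ 0 ≤ b) := by
    intro a b
    constructor
    · intro h
      rw [← sign_nonpos_iff, h, sign_nonpos_iff, ← sign_nonneg_iff, h, sign_nonneg_iff]
      exact ⟨Iff.rfl, Iff.rfl⟩
    · rintro ⟨h1, h2⟩
      rcases lt_trichotomy b 0 with hb | rfl | hb
      · rw [sign_neg hb, sign_neg (by rw [← not_le, h2]; exact hb.not_ge)]
      · rw [le_antisymm (h1.2 le_rfl) (h2.2 le_rfl)]
      · rw [sign_pos hb, sign_pos (by rw [← not_le, h1]; exact hb.not_ge)]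
  ext x
  have hx : x ∈ T.points ↔ (∀ i j, x i ≤ x j ↔ p i ≤ p j) ∧ (∀ i j, x i < x j + 1 ↔ p i < p j + 1) ∧
      ∀ i j, x i = x j + 1 ↔ p i = p j + 1 := by
    simp only [points, Set.mem_ofPred_eq, hp.1, hp.2.1, hp.2.2]
  rw [hx]
  simp only [Set.mem_ofPred_eq, sign_eq, Fin.forall_fin_two, Fin.val_zero, Fin.val_one,
    Nat.cast_zero, Nat.cast_one, sub_nonpos, sub_nonneg]
  constructor
  · rintro ⟨h1, h2, h3⟩ i j
    refine ⟨⟨h1 i j, h1 j i⟩, ?_, ?_⟩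
    · rw [sub_le_iff_le_add, sub_le_iff_le_add, add_comm 1, add_comm 1, le_iff_lt_or_eq,
        le_iff_lt_or_eq, h2, h3]
    · rw [le_sub_iff_add_le, le_sub_iff_add_le, add_comm 1, add_comm 1, ← not_lt, h2, not_lt]
  · intro h
    have h2 : ∀ i j, x j + 1 ≤ x i ↔ p j + 1 ≤ p i := fun i j => by
      have := (h i j).2.2
      rwa [le_sub_iff_add_le, le_sub_iff_add_le, add_comm 1, add_comm 1] at this
    have h3 : ∀ i j, x i ≤ x j + 1 ↔ p i ≤ p j + 1 := fun i j => by
      have := (h i j).2.1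
      rwa [sub_le_iff_le_add, sub_le_iff_le_add, add_comm 1, add_comm 1] at this
    refine ⟨fun i j => (h i j).1.1, fun i j => ?_, fun i j => ?_⟩
    · rw [← not_le, h2, not_le]
    · rw [le_antisymm_iff, h2, h3, ← le_antisymm_iff]

theorem isCatalanFace_points (T : DecoratedBinaryTree n) : IsCatalanFace T.points := by
  obtain ⟨p, hp⟩ := T.exists_mem_points
  exact ⟨⟨p, hp⟩, _, points_eq_of_mem hp⟩

theorem exists_points_eq {F : Set (Fin n → ℝ)} (hF : IsCatalanFace F) :
    ∃ T : DecoratedBinaryTree n, T.points = F := by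
  obtain ⟨⟨p, hp⟩, σ, rfl⟩ := hF
  obtain ⟨T, hT⟩ := exists_points_mem p
  refine ⟨T, ?_⟩
  -- A face is the sign class of any of its points: `p ∈ F` identifies `σ` with the signs at `p`.
  rw [points_eq_of_mem hT]
  simp only [hp _ _ _]

theorem finrank_direction_points (T : DecoratedBinaryTree n) :
    Module.finrank ℝ (affineSpan ℝ T.points).direction = T.numFree := by
  obtain ⟨p, hp⟩ := T.exists_mem_points
  rw [points_eq_of_mem hp, (mem_points_iff.1 hp).finrank_direction
    fun i hi => IsCaptive.exists_nodeOf hi, numFree]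
  congr 1
  ext u
  simp [freeNodes, exists_isNode_iff]

end DecoratedBinaryTree

theorem mainTheorem7 (n : ℕ) (hn : 1 ≤ n) :
    (∀ T : DecoratedBinaryTree n, ∃! F : CatalanFace n, F.1 = T.points) ∧
    ∃ Φ : DecoratedBinaryTree n → CatalanFace n,
      (∀ T, (Φ T).1 = T.points) ∧
      Function.Bijective Φ ∧
      ∀ T k, T.numFree = k ↔ (Φ T).dim = k := by
  refine ⟨fun T => ⟨⟨T.points, T.isCatalanFace_points⟩, rfl, fun F hF => Subtype.ext hF⟩,
    fun T => ⟨T.points, T.isCatalanFace_points⟩, fun T => rfl, ⟨fun T T' h => ?_, fun F => ?_⟩,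
    fun T k => ?_⟩
  · obtain ⟨p, hp⟩ := T.exists_mem_points
    have hpts : T.points = T'.points := congrArg Subtype.val h
    exact DecoratedBinaryTree.eq_of_mem_points hp (hpts ▸ hp)
  · obtain ⟨T, hT⟩ := DecoratedBinaryTree.exists_points_eq F.2
    exact ⟨T, Subtype.ext hT⟩
  · change _ ↔ Module.finrank ℝ (affineSpan ℝ T.points).direction = k
    rw [T.finrank_direction_points]
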